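/- Let $k$ be an algebraically closed field of characteristic $p>0$ and let $G$ be a finite unipotent group scheme over $k$, that is, an affine group scheme whose coordinate ring $k[G]$ has finite dimension over $k$ and for which every nonzero finite-dimensional representation has a nonzero fixed vector. Let $kG=\operatorname{Hom}_k(k[G],k)$ be its group algebra, with the Hopf algebra structure dual to that of $k[G]$. A finite-dimensional $kG$-module $M$ is called endotrivial if $\operatorname{Hom}_k(M,M)\cong k\oplus P$ as $kG$-modules for some projective $kG$-module $P$; here $k$ is the trivial module and $h\in kG$ acts on $\operatorname{Hom}_k(M,M)$ by $(hf)(m)=\sum h_{(1)}f(S(h_{(2)})m)$, where $S$ is the antipode of $kG$. Then for every positive integer $n$ there are, up to isomorphism, only finitely many endotrivial $kG$-modules $M$ with $\dim_k M=n$. -/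

import Mathlib

open TensorProduct Coalgebra AlgebraicGeometry CategoryTheory

universe u v w

noncomputable section

namespace FinGroupScheme

/-! ## The group algebra: the linear dual of the coordinate ring, as a Hopf algebra -/

/-- The linear dual of a Hopf algebra `A`, with the convolution product
`(f * g)(a) = ∑ f a₍₁₎ * g a₍₂₎`. If `A = k[G]`, this is the group algebra `kG`. -/
def GroupAlg (k : Type u) (A : Type v) [Field k] [Ring A] [HopfAlgebra k A] : Type (max u v) :=
  WithConv (A →ₗ[k] k)

namespace GroupAlg

variable (k : Type u) (A : Type v) [Field k] [Ring A] [HopfAlgebra k A]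

instance : Ring (GroupAlg k A) := inferInstanceAs (Ring (WithConv (A →ₗ[k] k)))

instance : Algebra k (GroupAlg k A) := inferInstanceAs (Algebra k (WithConv (A →ₗ[k] k)))

/-- The identification of `kG` with the linear dual of `A`, forgetting the product. -/
def toDual : GroupAlg k A ≃ₗ[k] Module.Dual k A where
  toFun f := WithConv.ofConv f
  invFun f := WithConv.toConv f
  map_add' _ _ := rfl
  map_smul' _ _ := rfl
  left_inv _ := rfl
  right_inv _ := rfl

lemma toDual_one (a : A) : toDual k A 1 a = counit (R := k) a := rfl

lemma toDual_mul (f g : GroupAlg k A) {ι : Type*} {a : A} (r : Coalgebra.Repr k a ι) :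
    toDual k A (f * g) a = ∑ i ∈ r.index, toDual k A f (r.left i) * toDual k A g (r.right i) :=
  r.convMul_apply (A := k) f g

variable [Module.Finite k A]

instance : Module.Finite k (GroupAlg k A) := Module.Finite.equiv (toDual k A).symm

/-- For finite-dimensional `A` the pairing `⟨f ⊗ g, a ⊗ b⟩ = f a * g b` identifies `kG ⊗ kG`
with the dual of `A ⊗ A`. -/
def pair : (GroupAlg k A ⊗[k] GroupAlg k A) ≃ₗ[k] Module.Dual k (A ⊗[k] A) :=
  (TensorProduct.congr (toDual k A) (toDual k A)).trans (TensorProduct.dualDistribEquiv k A A)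

lemma pair_tmul (f g : GroupAlg k A) (a b : A) :
    pair k A (f ⊗ₜ g) (a ⊗ₜ b) = toDual k A f a * toDual k A g b := rfl

/-- The comultiplication of `kG` is the transpose of the multiplication of `A`, so that
`∑ f₍₁₎ a * f₍₂₎ b = f (a * b)`; the counit is evaluation at `1`. -/
instance : CoalgebraStruct k (GroupAlg k A) where
  comul := (pair k A).symm.toLinearMap ∘ₗ (LinearMap.mul' k A).dualMap ∘ₗ
    (toDual k A).toLinearMap
  counit := LinearMap.applyₗ (1 : A) ∘ₗ (toDual k A).toLinearMap

lemma counit_apply (f : GroupAlg k A) : counit (R := k) f = toDual k A f 1 := rfl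

lemma pair_comul (f : GroupAlg k A) :
    pair k A (comul (R := k) f) = toDual k A f ∘ₗ LinearMap.mul' k A :=
  (pair k A).apply_symm_apply _

lemma pair_comul_tmul (f : GroupAlg k A) (a b : A) :
    pair k A (comul (R := k) f) (a ⊗ₜ b) = toDual k A f (a * b) := by
  rw [pair_comul]; rfl

lemma sum_repr {ι : Type*} {f : GroupAlg k A} (r : Coalgebra.Repr k f ι) (a b : A) :
    ∑ i ∈ r.index, toDual k A (r.left i) a * toDual k A (r.right i) b = toDual k A f (a * b) := by
  rw [← pair_comul_tmul, ← r.eq]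
  simp [map_sum, LinearMap.sum_apply, pair_tmul]

/-- The threefold analogue of `pair`, used for coassociativity. -/
def pair₃ : (GroupAlg k A ⊗[k] (GroupAlg k A ⊗[k] GroupAlg k A)) ≃ₗ[k]
    Module.Dual k (A ⊗[k] (A ⊗[k] A)) :=
  (TensorProduct.congr (toDual k A) (pair k A)).trans
    (TensorProduct.dualDistribEquiv k A (A ⊗[k] A))

lemma pair₃_tmul (f : GroupAlg k A) (x : GroupAlg k A ⊗[k] GroupAlg k A)
    (a : A) (y : A ⊗[k] A) :
    pair₃ k A (f ⊗ₜ x) (a ⊗ₜ y) = toDual k A f a * pair k A x y := rfl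

lemma pair₃_assoc (x : GroupAlg k A ⊗[k] GroupAlg k A) (g : GroupAlg k A) (a b c : A) :
    pair₃ k A (TensorProduct.assoc k _ _ _ (x ⊗ₜ g)) (a ⊗ₜ (b ⊗ₜ c)) =
      pair k A x (a ⊗ₜ b) * toDual k A g c := by
  induction x with
  | zero => simp
  | tmul f h => simp [pair₃_tmul, pair_tmul, mul_assoc]
  | add x y hx hy => simp [add_tmul, add_mul, hx, hy]

instance : Coalgebra k (GroupAlg k A) where
  coassoc := by
    refine LinearMap.ext fun f => (pair₃ k A).injective ?_
    refine TensorProduct.ext_threefold' fun a b c => ?_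
    obtain ⟨r⟩ : Nonempty (Coalgebra.Repr k f _) := ⟨Coalgebra.Repr.arbitrary k f⟩
    simp only [LinearMap.comp_apply, LinearEquiv.coe_coe]
    rw [← r.eq]
    simp only [map_sum, LinearMap.sum_apply, LinearMap.rTensor_tmul, LinearMap.lTensor_tmul,
      pair₃_assoc, pair₃_tmul, pair_comul_tmul]
    rw [sum_repr, sum_repr, mul_assoc]
  rTensor_counit_comp_comul := by
    refine LinearMap.ext fun f => ((TensorProduct.lid k _).trans (toDual k A)).injective ?_
    obtain ⟨r⟩ : Nonempty (Coalgebra.Repr k f _) := ⟨Coalgebra.Repr.arbitrary k f⟩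
    simp only [LinearMap.comp_apply]
    rw [← r.eq]
    refine LinearMap.ext fun a => ?_
    have := sum_repr k A r 1 a
    rw [one_mul] at this
    simpa [map_sum, LinearMap.sum_apply, counit_apply] using this
  lTensor_counit_comp_comul := by
    refine LinearMap.ext fun f => ((TensorProduct.rid k _).trans (toDual k A)).injective ?_
    obtain ⟨r⟩ : Nonempty (Coalgebra.Repr k f _) := ⟨Coalgebra.Repr.arbitrary k f⟩
    simp only [LinearMap.comp_apply]
    rw [← r.eq]
    refine LinearMap.ext fun a => ?_
    have := sum_repr k A r a 1
    rw [mul_one] at this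
    simpa [map_sum, LinearMap.sum_apply, counit_apply, mul_comm] using this

lemma pair_mul (x y : GroupAlg k A ⊗[k] GroupAlg k A) {ι κ : Type*} {a b : A}
    (ra : Coalgebra.Repr k a ι) (rb : Coalgebra.Repr k b κ) :
    pair k A (x * y) (a ⊗ₜ b) = ∑ i ∈ ra.index, ∑ j ∈ rb.index,
      pair k A x (ra.left i ⊗ₜ rb.left j) * pair k A y (ra.right i ⊗ₜ rb.right j) := by
  induction x with
  | zero => simp
  | add x x' hx hx' => simp [add_mul, hx, hx', Finset.sum_add_distrib]
  | tmul f g =>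
    induction y with
    | zero => simp
    | add y y' hy hy' => simp [mul_add, hy, hy', Finset.sum_add_distrib]
    | tmul f' g' =>
      rw [Algebra.TensorProduct.tmul_mul_tmul, pair_tmul, toDual_mul k A _ _ ra,
        toDual_mul k A _ _ rb, Finset.sum_mul_sum]
      refine Finset.sum_congr rfl fun i _ => Finset.sum_congr rfl fun j _ => ?_
      rw [pair_tmul, pair_tmul]
      ring

instance : Bialgebra k (GroupAlg k A) :=
  Bialgebra.mk' k (GroupAlg k A)
    (by simp [counit_apply, toDual_one])
    (by
      intro f g
      rw [counit_apply, counit_apply, counit_apply]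
      have h : toDual k A (f * g) 1 = LinearMap.mul' k k
        (TensorProduct.map (toDual k A f) (toDual k A g) (comul (R := k) (1 : A))) := rfl
      rw [h]
      simp [Algebra.TensorProduct.one_def])
    (by
      refine (pair k A).injective (TensorProduct.ext' fun a b => ?_)
      rw [pair_comul_tmul, Algebra.TensorProduct.one_def, pair_tmul]
      simp [toDual_one])
    (by
      intro f g
      refine (pair k A).injective (TensorProduct.ext' fun a b => ?_)
      let ra := Coalgebra.Repr.arbitrary k a
      let rb := Coalgebra.Repr.arbitrary k b
      rw [pair_mul k A _ _ ra rb, pair_comul_tmul, toDual_mul k A _ _ (ra.mul rb)]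
      simp only [pair_comul_tmul]
      exact Finset.sum_product _ _ _)

/-- The antipode of `kG` is the transpose of the antipode of `A`. -/
instance : HopfAlgebra k (GroupAlg k A) where
  antipode := (toDual k A).symm.toLinearMap ∘ₗ (HopfAlgebra.antipode k (A := A)).dualMap ∘ₗ
    (toDual k A).toLinearMap
  mul_antipode_rTensor_comul := by
    refine LinearMap.ext fun f => (toDual k A).injective (LinearMap.ext fun a => ?_)
    obtain ⟨r⟩ : Nonempty (Coalgebra.Repr k f _) := ⟨Coalgebra.Repr.arbitrary k f⟩
    let ra := Coalgebra.Repr.arbitrary k a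
    simp only [LinearMap.comp_apply]
    rw [← r.eq]
    simp only [map_sum, LinearMap.sum_apply, LinearMap.rTensor_tmul, LinearMap.mul'_apply,
      toDual_mul k A _ _ ra]
    rw [Finset.sum_comm]
    have h : ∀ j, ∑ i ∈ r.index, toDual k A (r.left i) (HopfAlgebra.antipode k (ra.left j)) *
        toDual k A (r.right i) (ra.right j) =
        toDual k A f (HopfAlgebra.antipode k (ra.left j) * ra.right j) :=
      fun j => sum_repr k A r _ _
    refine (Finset.sum_congr rfl fun j _ => h j).trans ?_
    rw [← map_sum, HopfAlgebra.sum_antipode_mul_eq_smul, map_smul, counit_apply,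
      Algebra.linearMap_apply, Algebra.algebraMap_eq_smul_one, map_smul, LinearMap.smul_apply,
      toDual_one, smul_eq_mul, smul_eq_mul, mul_comm]
  mul_antipode_lTensor_comul := by
    refine LinearMap.ext fun f => (toDual k A).injective (LinearMap.ext fun a => ?_)
    obtain ⟨r⟩ : Nonempty (Coalgebra.Repr k f _) := ⟨Coalgebra.Repr.arbitrary k f⟩
    let ra := Coalgebra.Repr.arbitrary k a
    simp only [LinearMap.comp_apply]
    rw [← r.eq]
    simp only [map_sum, LinearMap.sum_apply, LinearMap.lTensor_tmul, LinearMap.mul'_apply,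
      toDual_mul k A _ _ ra]
    rw [Finset.sum_comm]
    have h : ∀ j, ∑ i ∈ r.index, toDual k A (r.left i) (ra.left j) *
        toDual k A (r.right i) (HopfAlgebra.antipode k (ra.right j)) =
        toDual k A f (ra.left j * HopfAlgebra.antipode k (ra.right j)) :=
      fun j => sum_repr k A r _ _
    refine (Finset.sum_congr rfl fun j _ => h j).trans ?_
    rw [← map_sum, HopfAlgebra.sum_mul_antipode_eq_smul, map_smul, counit_apply,
      Algebra.linearMap_apply, Algebra.algebraMap_eq_smul_one, map_smul, LinearMap.smul_apply,
      toDual_one, smul_eq_mul, smul_eq_mul, mul_comm]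

end GroupAlg

/-! ## Modules over a Hopf algebra -/

/-- The ground field with the trivial action `h • c = ε(h) c` of a Hopf algebra `H`. -/
def TrivialMod (k : Type u) (H : Type v) [Field k] [Ring H] [HopfAlgebra k H] : Type u := k

namespace TrivialMod

variable (k : Type u) (H : Type v) [Field k] [Ring H] [HopfAlgebra k H]

instance : AddCommGroup (TrivialMod k H) := inferInstanceAs (AddCommGroup k)

instance : Module H (TrivialMod k H) :=
  Module.compHom k (Bialgebra.counitAlgHom k H).toRingHom

end TrivialMod

/-- The space `Hom_k(M, N)` of all `k`-linear maps between two modules over a Hopf algebra `H`,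
with the action `(h • f)(m) = ∑ h₍₁₎ • f (S(h₍₂₎) • m)`. -/
def HomMod (k : Type u) (H : Type v) (M N : Type w) [Field k] [Ring H] [HopfAlgebra k H]
    [AddCommGroup M] [Module k M] [AddCommGroup N] [Module k N] : Type w :=
  M →ₗ[k] N

namespace HomMod

variable (k : Type u) (H : Type v) (M N : Type w) [Field k] [Ring H] [HopfAlgebra k H]
  [AddCommGroup M] [Module k M] [Module H M] [IsScalarTower k H M]
  [AddCommGroup N] [Module k N] [Module H N] [IsScalarTower k H N]

instance : AddCommGroup (HomMod k H M N) := inferInstanceAs (AddCommGroup (M →ₗ[k] N))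

/-- The action of `H` on `Hom_k(M, N)` through the target: `f ↦ (m ↦ h • f m)`. -/
def actTarget : H →ₐ[k] Module.End k (M →ₗ[k] N) :=
  AlgHom.ofLinearMap
    (LinearMap.llcomp k M N N ∘ₗ (Algebra.lsmul k k N).toLinearMap)
    (by ext f m; simp) (by intro a b; ext f m; simp)

/-- The action of `H` on `Hom_k(M, N)` through the source: `f ↦ (m ↦ f (S(h) • m))`. -/
def actSource : H →ₐ[k] Module.End k (M →ₗ[k] N) :=
  AlgHom.ofLinearMap
    ((LinearMap.llcomp k M M N).flip ∘ₗ (Algebra.lsmul k k M).toLinearMap ∘ₗ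
      HopfAlgebra.antipode k (A := H))
    (by ext f m; simp)
    (by intro a b; ext f m; simp [HopfAlgebra.antipode_mul_antidistrib])

/-- The action of `H` on `Hom_k(M, N)`: `h` acts as `∑ actTarget h₍₁₎ * actSource h₍₂₎`. -/
def act : H →ₐ[k] Module.End k (M →ₗ[k] N) :=
  (Algebra.TensorProduct.lift (actTarget k H M N) (actSource k H M N)
    (by intro a b; ext f m; simp [actTarget, actSource])).comp (Bialgebra.comulAlgHom k H)

instance : Module H (HomMod k H M N) :=
  Module.compHom (M →ₗ[k] N) (act k H M N).toRingHom

/-- A `k`-linear map, seen as an element of the `H`-module `Hom_k(M, N)`. -/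
def of : (M →ₗ[k] N) ≃+ HomMod k H M N := AddEquiv.refl _

lemma smul_apply (h : H) {ι : Type*} (r : Coalgebra.Repr k h ι) (f : M →ₗ[k] N) (m : M) :
    (of k H M N).symm (h • of k H M N f) m =
      ∑ i ∈ r.index, r.left i • f (HopfAlgebra.antipode k (r.right i) • m) := by
  change act k H M N h f m = _
  simp only [act, AlgHom.comp_apply, Bialgebra.comulAlgHom_apply]
  rw [← r.eq]
  simp [map_sum, LinearMap.sum_apply, actTarget, actSource]

end HomMod

/-- A finite-dimensional module `M` over a Hopf algebra `H` is endotrivial if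
`Hom_k(M, M) ≅ k ⊕ P` as `H`-modules for some projective `H`-module `P`. -/
def IsEndotrivial (k : Type u) (H : Type v) (M : Type w) [Field k] [Ring H] [HopfAlgebra k H]
    [AddCommGroup M] [Module k M] [Module H M] [IsScalarTower k H M] : Prop :=
  Module.Finite k M ∧
    ∃ (P : Type w) (_ : AddCommGroup P) (_ : Module H P), Module.Projective H P ∧
      Nonempty (HomMod k H M M ≃ₗ[H] TrivialMod k H × P)

/-! ## Finite group schemes -/

/-- The coordinate ring `k[G]` of an affine group scheme `G` over a field `k`. -/
def CoordRing (k : Type u) [Field k] (G : Scheme.{u}) : Type u := Γ(G, ⊤)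

namespace CoordRing

variable (k : Type u) [Field k] (G : Scheme.{u})

instance : CommRing (CoordRing k G) := inferInstanceAs (CommRing Γ(G, ⊤))

/-- Mathlib's Hopf algebra structure on the global sections of an affine group scheme. -/
abbrev hopfAlgebraΓ (R : CommRingCat.{u}) (X : Scheme.{u}) [X.Over (Spec R)]
    [GrpObj (X.asOver (Spec R))] [IsAffine X] : HopfAlgebra R Γ(X, ⊤) :=
  inferInstance

/-- The Hopf algebra structure on `k[G]` that corresponds to the group structure of `G`. -/
instance [G.Over (Spec (.of k))] [GrpObj (G.asOver (Spec (.of k)))] [IsAffine G] :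
    HopfAlgebra k (CoordRing k G) :=
  hopfAlgebraΓ (.of k) G

end CoordRing

/-- The group algebra `kG` of a finite group scheme `G`: the dual of its coordinate ring. -/
abbrev GroupSchemeAlg (k : Type u) [Field k] (G : Scheme.{u}) [G.Over (Spec (.of k))]
    [GrpObj (G.asOver (Spec (.of k)))] [IsAffine G] : Type u :=
  GroupAlg k (CoordRing k G)

/-- A finite group scheme `G` is unipotent if every nonzero finite-dimensional representation
(that is, `kG`-module) `V` has a nonzero fixed vector. -/
def IsUnipotent (k : Type u) [Field k] (G : Scheme.{u}) [G.Over (Spec (.of k))]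
    [GrpObj (G.asOver (Spec (.of k)))] [IsAffine G] [Module.Finite k (CoordRing k G)] : Prop :=
  ∀ (V : Type u) [AddCommGroup V] [Module k V] [Module (GroupSchemeAlg k G) V]
    [IsScalarTower k (GroupSchemeAlg k G) V] [Module.Finite k V] [Nontrivial V],
    ∃ v : V, v ≠ 0 ∧ ∀ h : GroupSchemeAlg k G, h • v = counit (R := k) h • v

end FinGroupScheme

end

open FinGroupScheme

/-!
`kG` is cocommutative, and a nonzero submodule of a `kG`-module contains a nonzero invariant. It
follows that `kG` is local and Frobenius, and that its invariants form a line `k ∙ L`; so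
`v₁, …, v_r` span a free submodule of rank `r` as soon as `L • v₁, …, L • v_r` are linearly
independent.

If `M` is endotrivial, then `Hom(M, M) ≅ k ⊕ kG ^ r`. The condition that the basis `f₁, …, f_r` of
`kG ^ r` should also span a free submodule of rank `r` in `Hom(M, N)` is open in the space of module
structures `N` on `k ^ n`, because it is tested by the linear independence of `L • f₁, …, L • f_r`.
When it holds, `Hom(M, N) ≅ k ⊕ kG ^ r` by a count of dimensions, and

`N ⊕ free ≅ Hom(M, M) ⊗ N ≅ Hom(M, N) ⊗ M ≅ M ⊕ free`,

so `M ≅ N` by cancellation. Isomorphism classes of endotrivial modules are thus open, and they are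
finitely many because the space of module structures is noetherian.
-/

namespace FinGroupScheme

noncomputable section

/-! ## Cocommutative Hopf algebras -/

lemma GroupAlg.pair_comm (k : Type u) (A : Type v) [Field k] [Ring A] [HopfAlgebra k A]
    [Module.Finite k A] (x : GroupAlg k A ⊗[k] GroupAlg k A) (a b : A) :
    pair k A (TensorProduct.comm k _ _ x) (a ⊗ₜ b) = pair k A x (b ⊗ₜ a) := by
  induction x with
  | zero => simp
  | tmul f g => simp [pair_tmul, mul_comm]
  | add x y hx hy => simp [hx, hy]

instance GroupAlg.instIsCocomm (k : Type u) (A : Type v) [Field k] [CommRing A] [HopfAlgebra k A]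
    [Module.Finite k A] : IsCocomm k (GroupAlg k A) where
  comm_comp_comul :=
    LinearMap.ext fun f => (pair k A).injective <| TensorProduct.ext' fun a b =>
      (pair_comm k A _ a b).trans <| by rw [pair_comul_tmul, pair_comul_tmul, mul_comm]

section Coalgebra

variable {k H W ι : Type*} [CommRing k] [AddCommGroup H] [Module k H] [Coalgebra k H]
  [AddCommGroup W] [Module k W] {h : H}

/-- The coproduct of an element of a cocommutative coalgebra with its two factors exchanged. -/
@[simps]
def reprSwap [IsCocomm k H] (r : Coalgebra.Repr k h ι) : Coalgebra.Repr k h ι where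
  index := r.index
  left := r.right
  right := r.left
  eq := by
    rw [← comm_comul k h, ← r.eq]
    simp [map_sum]

lemma sum_counit_right_smul (r : Coalgebra.Repr k h ι) :
    ∑ i ∈ r.index, counit (R := k) (r.right i) • r.left i = h := by
  simpa only [map_sum, rid_tmul, one_smul] using
    congrArg (TensorProduct.rid k H) (Coalgebra.sum_tmul_counit_eq r)

lemma sum_repr_assoc {κ μ : ι → Type*} (r : Coalgebra.Repr k h ι)
    (r₁ : ∀ i, Coalgebra.Repr k (r.left i) (κ i)) (r₂ : ∀ i, Coalgebra.Repr k (r.right i) (μ i))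
    {T : H → H → H → W} (h₁ : ∀ b c, IsLinearMap k (T · b c))
    (h₂ : ∀ a c, IsLinearMap k (T a · c)) (h₃ : ∀ a b, IsLinearMap k (T a b ·)) :
    ∑ i ∈ r.index, ∑ j ∈ (r₁ i).index, T ((r₁ i).left j) ((r₁ i).right j) (r.right i) =
      ∑ i ∈ r.index, ∑ j ∈ (r₂ i).index, T (r.left i) ((r₂ i).left j) ((r₂ i).right j) := by
  let T₂ : H → H →ₗ[k] H →ₗ[k] W := fun a => LinearMap.mk₂ k (T a)
    (fun x y c => (h₂ a c).map_add x y) (fun t x c => (h₂ a c).map_smul t x)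
    (fun b => (h₃ a b).map_add) (fun t b => (h₃ a b).map_smul t)
  let T₁ : H →ₗ[k] (H ⊗[k] H) →ₗ[k] W :=
    { toFun a := TensorProduct.lift (T₂ a)
      map_add' x y := TensorProduct.ext' fun b c => by simpa [T₂] using (h₁ b c).map_add x y
      map_smul' t x := TensorProduct.ext' fun b c => by simpa [T₂] using (h₁ b c).map_smul t x }
  simpa [T₁, T₂] using congrArg (TensorProduct.lift T₁) (Coalgebra.sum_tmul_tmul_eq r r₁ r₂)

lemma sum_repr_swap_right [IsCocomm k H] {κ : ι → Type*} (r : Coalgebra.Repr k h ι)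
    (r₁ : ∀ i, Coalgebra.Repr k (r.left i) (κ i)) {T : H → H → H → W}
    (h₁ : ∀ b c, IsLinearMap k (T · b c)) (h₂ : ∀ a c, IsLinearMap k (T a · c))
    (h₃ : ∀ a b, IsLinearMap k (T a b ·)) :
    ∑ i ∈ r.index, ∑ j ∈ (r₁ i).index, T ((r₁ i).left j) ((r₁ i).right j) (r.right i) =
      ∑ i ∈ r.index, ∑ j ∈ (r₁ i).index, T ((r₁ i).left j) (r.right i) ((r₁ i).right j) :=
  (sum_repr_assoc r r₁ (fun i => ℛ k (r.right i)) h₁ h₂ h₃).trans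
    (sum_repr_assoc (T := fun a b c => T a c b) r r₁ (fun i => reprSwap (ℛ k (r.right i)))
      (fun b c => h₁ c b) (fun a c => h₃ a c) (fun a b => h₂ a b)).symm

end Coalgebra

section Antipode

variable {k H ι : Type*} [CommRing k] [Ring H] [HopfAlgebra k H] {h : H}

lemma sum_antipode_tmul_one_mul_comul (r : Coalgebra.Repr k h ι) :
    ∑ i ∈ r.index, (HopfAlgebra.antipode k (r.left i) ⊗ₜ[k] (1 : H)) * comul (R := k) (r.right i) =
      1 ⊗ₜ[k] h := by
  have key := sum_repr_assoc r (fun i => ℛ k (r.left i)) (fun i => ℛ k (r.right i))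
    (T := fun a b c => (HopfAlgebra.antipode k a * b) ⊗ₜ[k] c)
    (fun b c => ⟨by simp [add_mul, add_tmul], by simp [smul_tmul']⟩)
    (fun a c => ⟨by simp [mul_add, add_tmul], by simp [smul_tmul']⟩)
    (fun a b => ⟨by simp [tmul_add], by simp⟩)
  calc _ = ∑ i ∈ r.index, ∑ j ∈ (ℛ k (r.right i)).index,
        (HopfAlgebra.antipode k (r.left i) * (ℛ k (r.right i)).left j) ⊗ₜ[k]
          (ℛ k (r.right i)).right j := Finset.sum_congr rfl fun i _ => by
        rw [← (ℛ k (r.right i)).eq, Finset.mul_sum]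
        simp only [Algebra.TensorProduct.tmul_mul_tmul, one_mul]
    _ = ∑ i ∈ r.index, (counit (R := k) (r.left i) • (1 : H)) ⊗ₜ[k] r.right i := by
        simp only [← key, ← sum_tmul, HopfAlgebra.sum_antipode_mul_eq_smul]
    _ = _ := by simp only [smul_tmul, ← tmul_sum, Coalgebra.sum_counit_smul]

lemma sum_comul_mul_one_tmul_antipode (r : Coalgebra.Repr k h ι) :
    ∑ i ∈ r.index, comul (R := k) (r.left i) * ((1 : H) ⊗ₜ[k] HopfAlgebra.antipode k (r.right i)) =
      h ⊗ₜ[k] 1 := by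
  have key := sum_repr_assoc r (fun i => ℛ k (r.left i)) (fun i => ℛ k (r.right i))
    (T := fun a b c => a ⊗ₜ[k] (b * HopfAlgebra.antipode k c))
    (fun b c => ⟨by simp [add_tmul], by simp [smul_tmul']⟩)
    (fun a c => ⟨by simp [add_mul, tmul_add], by simp⟩)
    (fun a b => ⟨by simp [mul_add, tmul_add], by simp⟩)
  calc _ = ∑ i ∈ r.index, ∑ j ∈ (ℛ k (r.left i)).index, (ℛ k (r.left i)).left j ⊗ₜ[k]
        ((ℛ k (r.left i)).right j * HopfAlgebra.antipode k (r.right i)) :=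
        Finset.sum_congr rfl fun i _ => by
          rw [← (ℛ k (r.left i)).eq, Finset.sum_mul]
          simp only [Algebra.TensorProduct.tmul_mul_tmul, mul_one]
    _ = ∑ i ∈ r.index, r.left i ⊗ₜ[k] (counit (R := k) (r.right i) • (1 : H)) := by
        simp only [key, ← tmul_sum, HopfAlgebra.sum_mul_antipode_eq_smul]
    _ = _ := by simp only [← smul_tmul, ← sum_tmul, sum_counit_right_smul]

variable (k H) in
lemma antipode_comp_antipode [IsCocomm k H] :
    HopfAlgebra.antipode k (A := H) ∘ₗ HopfAlgebra.antipode k = LinearMap.id := by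
  have h_left_inv : WithConv.toConv (HopfAlgebra.antipode k (A := H) ∘ₗ HopfAlgebra.antipode k) *
      WithConv.toConv (HopfAlgebra.antipode k (A := H)) = 1 := by
    ext h
    rw [(reprSwap (ℛ k h)).convMul_apply]
    simp [← HopfAlgebra.antipode_mul_antidistrib, ← map_sum,
      HopfAlgebra.sum_mul_antipode_eq_algebraMap_counit, Algebra.algebraMap_eq_smul_one,
      HopfAlgebra.antipode_one]
  exact congrArg WithConv.ofConv (left_inv_eq_right_inv h_left_inv LinearMap.antipode_mul_id)

@[simp]
lemma antipode_antipode [IsCocomm k H] (h : H) :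
    HopfAlgebra.antipode k (HopfAlgebra.antipode k h) = h :=
  LinearMap.congr_fun (antipode_comp_antipode k H) h

end Antipode

/-! ## Fixed vectors -/

section FixedVectors

/-- The fixed vectors of a module over a bialgebra. -/
def invariants (k H V : Type*) [Field k] [Ring H] [Bialgebra k H] [AddCommGroup V] [Module k V]
    [Module H V] : Submodule H V where
  carrier := {v | ∀ h : H, h • v = counit (R := k) h • v}
  add_mem' hv hw h := by rw [smul_add, smul_add, hv, hw]
  zero_mem' h := by rw [smul_zero, smul_zero]
  smul_mem' g v hv h := by rw [← mul_smul, hv, hv g, Bialgebra.counit_mul, mul_smul]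

lemma mem_invariants {k H V : Type*} [Field k] [Ring H] [Bialgebra k H] [AddCommGroup V]
    [Module k V] [Module H V] {v : V} :
    v ∈ invariants k H V ↔ ∀ h : H, h • v = counit (R := k) h • v := Iff.rfl

/-- Every nonzero finite-dimensional `H`-module has a nonzero fixed vector. For `H = kG` this says
that the group scheme `G` is unipotent. -/
def HasFixedVectors (k : Type v) (H : Type u) [Field k] [Ring H] [Bialgebra k H] : Prop :=
  ∀ (V : Type u) [AddCommGroup V] [Module k V] [Module H V] [IsScalarTower k H V]
    [Module.Finite k V] [Nontrivial V],
    ∃ v : V, v ≠ 0 ∧ ∀ h : H, h • v = counit (R := k) h • v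

namespace HasFixedVectors

variable {k : Type v} {H V : Type u} [Field k] [Ring H] [Bialgebra k H] [AddCommGroup V]
  [Module k V] [Module H V] [IsScalarTower k H V] [Module.Finite k V]

lemma exists_mem_invariants (hH : HasFixedVectors k H) {S : Submodule H V} (hS : S ≠ ⊥) :
    ∃ v ∈ S, v ≠ 0 ∧ v ∈ invariants k H V := by
  have : Nontrivial S := Submodule.nontrivial_iff_ne_bot.2 hS
  have : Module.Finite k S := inferInstanceAs (Module.Finite k (S.restrictScalars k))
  obtain ⟨v, hv, hfix⟩ := hH S
  exact ⟨v, v.2, by simpa using hv, fun h => congrArg Subtype.val (hfix h)⟩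

lemma injective_of_invariants (hH : HasFixedVectors k H) {W : Type*} [AddCommGroup W]
    [Module H W] (f : V →ₗ[H] W) (hf : ∀ v ∈ invariants k H V, f v = 0 → v = 0) :
    Function.Injective f := by
  rw [← LinearMap.ker_eq_bot]
  by_contra h
  obtain ⟨v, hv, hv0, hfix⟩ := hH.exists_mem_invariants h
  exact hv0 (hf v hfix hv)

lemma invariants_eq_top [IsSimpleModule H V] (hH : HasFixedVectors k H) :
    invariants k H V = ⊤ := by
  have : Nontrivial V := IsSimpleModule.nontrivial H V
  refine (eq_bot_or_eq_top _).resolve_left fun h => ?_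
  obtain ⟨v, hv, hfix⟩ := hH V
  exact hv ((Submodule.mem_bot H).1 (h ▸ mem_invariants.2 hfix))

variable [Module.Finite k H]

lemma eq_top_of_counit_ne_zero (hH : HasFixedVectors k H) {J : Ideal H} {x : H} (hxJ : x ∈ J)
    (hx : counit (R := k) x ≠ 0) : J = ⊤ := by
  by_contra hJ
  obtain ⟨m, hm, hJm⟩ := Ideal.exists_le_maximal J hJ
  have : IsSimpleModule H (H ⧸ m) := isSimpleModule_iff_isCoatom.2 hm.1
  have : Module.Finite k (H ⧸ m) :=
    Module.Finite.of_surjective (m.mkQ.restrictScalars k) m.mkQ_surjective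
  have h_fixed : m.mkQ 1 ∈ invariants k H (H ⧸ m) :=
    hH.invariants_eq_top (V := H ⧸ m) ▸ Submodule.mem_top
  have h_smul : counit (R := k) x • m.mkQ 1 = 0 := by
    rw [← h_fixed x, ← map_smul, smul_eq_mul, mul_one]
    exact (Submodule.Quotient.mk_eq_zero m).2 (hJm hxJ)
  have h_one : m.mkQ 1 = 0 := (smul_eq_zero.1 h_smul).resolve_left hx
  exact hm.ne_top ((Ideal.eq_top_iff_one m).2 ((Submodule.Quotient.mk_eq_zero m).1 h_one))

lemma isUnit_of_counit_ne_zero (hH : HasFixedVectors k H) {x : H} (hx : counit (R := k) x ≠ 0) :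
    IsUnit x := by
  have : IsNoetherianRing H := isNoetherian_of_tower k inferInstance
  have h_span := hH.eq_top_of_counit_ne_zero (Ideal.mem_span_singleton_self x) hx
  obtain ⟨y, hy⟩ := Ideal.mem_span_singleton'.1 (h_span ▸ Submodule.mem_top : (1 : H) ∈ _)
  exact IsUnit.of_mul_eq_one_right y hy

lemma isLocalRing (hH : HasFixedVectors k H) : IsLocalRing H := by
  have : Nontrivial H := (Bialgebra.counitAlgHom k H).toRingHom.domain_nontrivial
  refine IsLocalRing.of_is_unit_or_is_unit_of_add_one fun {a b} hab => ?_
  have h_counit : counit (R := k) a + counit (R := k) b = 1 := by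
    rw [← map_add, hab, Bialgebra.counit_one]
  by_cases ha : counit (R := k) a = 0
  · exact .inr (hH.isUnit_of_counit_ne_zero (k := k) (by simp_all))
  · exact .inl (hH.isUnit_of_counit_ne_zero ha)

end HasFixedVectors

end FixedVectors

/-! ## Cancellation over local rings -/

section Cancellation

variable {R B C : Type*} [Ring R] [AddCommGroup B] [Module R B] [AddCommGroup C] [Module R C]

/-- The kernel of a linear form on `R × C` that takes an invertible value at `(1, 0)` is a
complement of `R`, hence isomorphic to `C`. -/
def kerEquivOfIsUnit (p : R × C →ₗ[R] R) (hp : IsUnit (p (1, 0))) : LinearMap.ker p ≃ₗ[R] C :=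
  LinearEquiv.ofBijective (LinearMap.snd R R C ∘ₗ (LinearMap.ker p).subtype) <| by
    have h_bij := IsUnit.isUnit_iff_mulRight_bijective.1 hp
    have h_left : ∀ a, p (a, 0) = a * p (1, 0) := fun a => by
      rw [← smul_eq_mul, ← map_smul, Prod.smul_mk, smul_eq_mul, mul_one, smul_zero]
    refine ⟨(injective_iff_map_eq_zero _).2 ?_, fun c => ?_⟩
    · rintro ⟨⟨a, c⟩, hac⟩ (rfl : c = 0)
      have h_zero : a * p (1, 0) = 0 * p (1, 0) := by rw [zero_mul, ← h_left]; exact hac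
      simpa using h_bij.1 h_zero
    · obtain ⟨a, ha⟩ := h_bij.2 (-p (0, c))
      have h_mem : p (a, c) = 0 := by
        rw [← zero_add c, ← add_zero a, ← Prod.mk_add_mk, map_add, h_left]
        simp [show a * p (1, 0) = _ from ha]
      exact ⟨⟨(a, c), h_mem⟩, rfl⟩

variable (R B) in
/-- Splits off the first coordinate of a free summand of rank `n + 1`. -/
def prodFinSuccEquiv (n : ℕ) : (B × (Fin (n + 1) → R)) ≃ₗ[R] R × (B × (Fin n → R)) :=
  (LinearEquiv.refl R B).prodCongr (Fin.consLinearEquiv R fun _ => R).symm ≪≫ₗ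
    LinearEquiv.prodComm R _ _ ≪≫ₗ LinearEquiv.prodAssoc R _ _ _ ≪≫ₗ
    (LinearEquiv.refl R R).prodCongr (LinearEquiv.prodComm R _ _)

variable [IsLocalRing R]

lemma isUnit_one_add_of_not_isUnit {a : R} (ha : ¬IsUnit a) : IsUnit (1 + a) :=
  (IsLocalRing.isUnit_or_isUnit_of_add_one (add_neg_cancel_right 1 a)).resolve_right
    fun h => ha (by simpa using h.neg)

lemma exists_isUnit_apply_inl (e : (R × B) ≃ₗ[R] R × C) :
    ∃ p : R × C →ₗ[R] R, IsUnit (p (1, 0)) ∧ IsUnit (p (e (1, 0))) := by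
  by_cases ha : IsUnit (e (1, 0)).1
  · exact ⟨LinearMap.fst R R C, isUnit_one, ha⟩
  by_cases hb : IsUnit (e.symm (1, 0)).1
  · exact ⟨LinearMap.fst R R B ∘ₗ e.symm, hb, by simp⟩
  refine ⟨LinearMap.fst R R C + LinearMap.fst R R B ∘ₗ e.symm, ?_, ?_⟩
  · simpa using isUnit_one_add_of_not_isUnit hb
  · simpa [add_comm] using isUnit_one_add_of_not_isUnit ha

lemma nonempty_equiv_of_prod_equiv_prod (e : (R × B) ≃ₗ[R] R × C) : Nonempty (B ≃ₗ[R] C) := by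
  obtain ⟨p, hp, hpe⟩ := exists_isUnit_apply_inl e
  exact ⟨(kerEquivOfIsUnit (p ∘ₗ e) hpe).symm ≪≫ₗ e.ofSubmodule' (LinearMap.ker p) ≪≫ₗ
    kerEquivOfIsUnit p hp⟩

lemma nonempty_equiv_of_prod_fin_equiv (n : ℕ) (e : (B × (Fin n → R)) ≃ₗ[R] C × (Fin n → R)) :
    Nonempty (B ≃ₗ[R] C) := by
  induction n with
  | zero => exact ⟨LinearEquiv.prodUnique.symm ≪≫ₗ e ≪≫ₗ LinearEquiv.prodUnique⟩
  | succ n ih =>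
    obtain ⟨e'⟩ := nonempty_equiv_of_prod_equiv_prod
      ((prodFinSuccEquiv R B n).symm ≪≫ₗ e ≪≫ₗ prodFinSuccEquiv R C n)
    exact ih e'

lemma nonempty_equiv_of_prod_pi_equiv {ι : Type*} [Finite ι]
    (e : (B × (ι → R)) ≃ₗ[R] C × (ι → R)) : Nonempty (B ≃ₗ[R] C) := by
  obtain ⟨n, ⟨σ⟩⟩ := Finite.exists_equiv_fin ι
  have reindex := LinearEquiv.funCongrLeft R R σ
  exact nonempty_equiv_of_prod_fin_equiv n <|
    (LinearEquiv.refl R B).prodCongr reindex ≪≫ₗ e ≪≫ₗ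
      (LinearEquiv.refl R C).prodCongr reindex.symm

end Cancellation

/-! ## Frobenius forms -/

section FrobeniusForm

variable {k A : Type*} [Field k] [Ring A] [Algebra k A]

/-- A functional `l` on an algebra `A` such that `(x, a) ↦ l (x * a)` is a perfect pairing. -/
def IsFrobeniusForm (l : Module.Dual k A) : Prop :=
  Function.Bijective fun a : A => l ∘ₗ LinearMap.mulRight k a

namespace IsFrobeniusForm

variable {l : Module.Dual k A} {V : Type*} [AddCommGroup V] [Module A V]

lemma eq_of_forall (hl : IsFrobeniusForm l) {a b : A} (h : ∀ x, l (x * a) = l (x * b)) : a = b :=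
  hl.1 (LinearMap.ext h)

lemma linearMap_ext (hl : IsFrobeniusForm l) {f g : V →ₗ[A] A} (h : ∀ v, l (f v) = l (g v)) :
    f = g :=
  LinearMap.ext fun v => hl.eq_of_forall fun x => by
    rw [← smul_eq_mul, ← smul_eq_mul, ← map_smul, ← map_smul, h]

variable [Module k V] [IsScalarTower k A V]

lemma exists_linearMap_apply_eq (hl : IsFrobeniusForm l) (μ : Module.Dual k V) :
    ∃ q : V →ₗ[A] A, ∀ v, l (q v) = μ v := by
  have h_rep (v : V) : ∃ a, ∀ x, l (x * a) = μ (x • v) := by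
    obtain ⟨a, ha⟩ := hl.2 (μ ∘ₗ (LinearMap.toSpanSingleton A V v).restrictScalars k)
    exact ⟨a, LinearMap.congr_fun ha⟩
  choose q hq using h_rep
  exact ⟨{
    toFun := q
    map_add' v w := hl.eq_of_forall fun x => by simp only [mul_add, map_add, hq, smul_add]
    map_smul' a v := hl.eq_of_forall fun x => by
      rw [hq, RingHom.id_apply, smul_eq_mul, ← mul_assoc, hq, mul_smul] },
    fun v => by simpa using hq v 1⟩

lemma exists_leftInverse (hl : IsFrobeniusForm l) {ι : Type*} (j : (ι → A) →ₗ[A] V)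
    (hj : Function.Injective j) : ∃ q : V →ₗ[A] (ι → A), q ∘ₗ j = LinearMap.id := by
  obtain ⟨ρ, hρ⟩ :=
    (j.restrictScalars k).exists_leftInverse_of_injective (LinearMap.ker_eq_bot.2 hj)
  choose q hq using fun i => hl.exists_linearMap_apply_eq (l ∘ₗ LinearMap.proj i ∘ₗ ρ)
  have h_proj (i : ι) : q i ∘ₗ j = LinearMap.proj i := hl.linearMap_ext fun x => by
    rw [LinearMap.comp_apply, hq]
    exact congrArg (fun y => l (y i)) (LinearMap.congr_fun hρ x)
  exact ⟨LinearMap.pi q, LinearMap.ext fun x => funext fun i => LinearMap.congr_fun (h_proj i) x⟩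

end IsFrobeniusForm

end FrobeniusForm

/-! ## Integrals of a Hopf algebra -/

section Integral

variable {k H : Type*} [Field k] [Ring H] [HopfAlgebra k H]

/-- Contraction of the first factor of the coproduct of `x` with a functional. -/
def contract (x : H) : Module.Dual k H →ₗ[k] H :=
  (TensorProduct.lid k H).toLinearMap ∘ₗ
    (LinearMap.rTensorHom H : Module.Dual k H →ₗ[k] _).flip (comul (R := k) x)

lemma contract_apply (x : H) (φ : Module.Dual k H) :
    contract x φ = TensorProduct.lid k H (φ.rTensor H (comul (R := k) x)) := rfl

lemma counit_contract (x : H) (φ : Module.Dual k H) : counit (R := k) (contract x φ) = φ x := by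
  conv_rhs => rw [← sum_counit_right_smul (ℛ k x), map_sum]
  rw [contract_apply, ← (ℛ k x).eq]
  simp [mul_comm]

lemma one_tmul_mul_comul {L : H} (hL : L ∈ invariants k H H) (h : H) :
    ((1 : H) ⊗ₜ[k] h) * comul (R := k) L =
      (HopfAlgebra.antipode k h ⊗ₜ[k] (1 : H)) * comul (R := k) L := by
  have h_mul (g : H) : comul (R := k) g * comul (R := k) L =
      counit (R := k) g • comul (R := k) L := by
    rw [← Bialgebra.comul_mul, ← map_smul, ← hL g, smul_eq_mul]
  rw [← sum_antipode_tmul_one_mul_comul (ℛ k h), Finset.sum_mul]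
  simp only [mul_assoc, h_mul]
  conv_rhs => rw [← sum_counit_right_smul (ℛ k h)]
  simp only [map_sum, map_smul, sum_tmul, Finset.sum_mul, ← smul_tmul', smul_mul_assoc,
    mul_smul_comm]

lemma mul_contract {L : H} (hL : L ∈ invariants k H H) (h : H) (φ : Module.Dual k H) :
    h * contract L φ = contract L (φ ∘ₗ LinearMap.mulLeft k (HopfAlgebra.antipode k h)) := by
  have h_right (z : H ⊗[k] H) : h * TensorProduct.lid k H (φ.rTensor H z) =
      TensorProduct.lid k H (φ.rTensor H ((1 ⊗ₜ h) * z)) := by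
    induction z with
    | zero => simp
    | tmul a b => simp
    | add z w hz hw => simp [mul_add, hz, hw]
  have h_left (a : H) (z : H ⊗[k] H) : TensorProduct.lid k H (φ.rTensor H ((a ⊗ₜ 1) * z)) =
      TensorProduct.lid k H ((φ ∘ₗ LinearMap.mulLeft k a).rTensor H z) := by
    induction z with
    | zero => simp
    | tmul b c => simp
    | add z w hz hw => simp [mul_add, hz, hw]
  rw [contract_apply, contract_apply, h_right, one_tmul_mul_comul hL, h_left]

lemma IsFrobeniusForm.exists_span_eq_invariants {l : Module.Dual k H} (hl : IsFrobeniusForm l) :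
    ∃ L : H, L ≠ 0 ∧ (invariants k H H).restrictScalars k = k ∙ L := by
  obtain ⟨L, hL⟩ := hl.2 (counit (R := k) (A := H))
  replace hL (x : H) : l (x * L) = counit (R := k) x := LinearMap.congr_fun hL x
  have hL0 : L ≠ 0 := by
    rintro rfl
    simpa using hL 1
  refine ⟨L, hL0, le_antisymm (fun v hv => ?_) ?_⟩
  · refine Submodule.mem_span_singleton.2 ⟨l v, hl.eq_of_forall fun x => ?_⟩
    rw [mul_smul_comm, map_smul, hL, ← smul_eq_mul x v, hv x, map_smul, smul_eq_mul, smul_eq_mul,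
      mul_comm]
  · rw [Submodule.span_singleton_le_iff_mem]
    refine fun h => hl.eq_of_forall fun x => ?_
    rw [smul_eq_mul, ← mul_assoc, hL, mul_smul_comm, map_smul, hL, Bialgebra.counit_mul,
      smul_eq_mul, mul_comm]

end Integral

namespace HasFixedVectors

variable {k : Type v} {H : Type u} [Field k] [Ring H] [HopfAlgebra k H] [Module.Finite k H]

lemma contract_bijective (hH : HasFixedVectors k H) {L : H} (hL0 : L ≠ 0)
    (hL : L ∈ invariants k H H) : Function.Bijective (contract (k := k) L) := by
  have h_surj : Function.Surjective (contract (k := k) L) := by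
    let J : Ideal H :=
      { (LinearMap.range (contract (k := k) L)) with
        smul_mem' := by
          rintro h _ ⟨φ, rfl⟩
          exact ⟨_, (mul_contract hL h φ).symm⟩ }
    obtain ⟨φ, hφ⟩ : ∃ φ : Module.Dual k H, φ L ≠ 0 := by
      simpa using (Module.forall_dual_apply_eq_zero_iff k L).not.2 hL0
    have hJ : J = ⊤ := hH.eq_top_of_counit_ne_zero (x := contract L φ) ⟨φ, rfl⟩
      (by rwa [counit_contract])
    exact fun y => (hJ ▸ Submodule.mem_top : y ∈ J)
  exact ⟨(LinearMap.injective_iff_surjective_of_finrank_eq_finrank Subspace.dual_finrank_eq).2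
    h_surj, h_surj⟩

lemma exists_isFrobeniusForm [IsCocomm k H] (hH : HasFixedVectors k H) :
    ∃ l : Module.Dual k H, IsFrobeniusForm l := by
  have : Nontrivial H := (Bialgebra.counitAlgHom k H).toRingHom.domain_nontrivial
  obtain ⟨L, hL0, hL⟩ := hH H
  let C := LinearEquiv.ofBijective (contract (k := k) L) (hH.contract_bijective hL0 hL)
  let S := LinearEquiv.ofInvolutive (HopfAlgebra.antipode k (A := H)) antipode_antipode
  have h_mul (x y : H) : C.symm (x * y) = C.symm y ∘ₗ LinearMap.mulLeft k (S x) := by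
    rw [C.symm_apply_eq]
    exact (congrArg (x * ·) (C.apply_symm_apply y).symm).trans (mul_contract hL x (C.symm y))
  have h_form : (fun y => (LinearMap.applyₗ 1 ∘ₗ C.symm.toLinearMap) ∘ₗ LinearMap.mulRight k y) =
      C.symm ≪≫ₗ S.dualMap := by
    ext y x
    simp [h_mul, S]
  exact ⟨_, (congrArg Function.Bijective h_form).mpr (C.symm ≪≫ₗ S.dualMap).bijective⟩

end HasFixedVectors

/-! ## Free modules -/

section MapInvariants

variable {k H V W : Type*} [Field k] [Ring H] [Bialgebra k H] [AddCommGroup V] [Module k V]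
  [Module H V] [IsScalarTower k H V] [AddCommGroup W] [Module k W] [Module H W]
  [IsScalarTower k H W]

lemma map_mem_invariants (f : V →ₗ[H] W) {v : V} (hv : v ∈ invariants k H V) :
    f v ∈ invariants k H W := fun h => by
  rw [← map_smul, hv h, f.map_smul_of_tower]

lemma exists_smul_eq_of_mem_invariants [Module.Projective H V] {L : H}
    (hL : (invariants k H H).restrictScalars k = k ∙ L) {v : V} (hv : v ∈ invariants k H V) :
    ∃ u : V, L • u = v := by
  obtain ⟨s, hs⟩ := Module.projective_def'.1 (inferInstance : Module.Projective H V)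
  have h_coord (x : V) : ∃ c : k, c • L = s v x :=
    Submodule.mem_span_singleton.1 <|
      hL ▸ map_mem_invariants (Finsupp.lapply x ∘ₗ s : V →ₗ[H] H) hv
  choose c hc using h_coord
  refine ⟨∑ x ∈ (s v).support, c x • x, ?_⟩
  calc L • ∑ x ∈ (s v).support, c x • x = ∑ x ∈ (s v).support, s v x • x := by
        rw [Finset.smul_sum]
        exact Finset.sum_congr rfl fun x _ => by rw [← hc, smul_comm, smul_assoc]
    _ = v := LinearMap.congr_fun hs v

end MapInvariants

namespace HasFixedVectors

variable {k : Type v} {H V : Type u} [Field k] [Ring H] [HopfAlgebra k H] [Module.Finite k H]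
  [AddCommGroup V] [Module k V] [Module H V] [IsScalarTower k H V] {l : Module.Dual k H} {L : H}

lemma linearCombination_injective (hH : HasFixedVectors k H)
    (hL : (invariants k H H).restrictScalars k = k ∙ L) {r : ℕ} {y : Fin r → V}
    (hy : LinearIndependent k fun i => L • y i) :
    Function.Injective (Fintype.linearCombination H y) := by
  refine hH.injective_of_invariants _ fun v hv hv0 => ?_
  have h_coord (i : Fin r) : ∃ c : k, c • L = v i :=
    Submodule.mem_span_singleton.1 <|
      hL ▸ map_mem_invariants (LinearMap.proj i : (Fin r → H) →ₗ[H] H) hv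
  choose c hc using h_coord
  have h_sum : ∑ i, c i • L • y i = 0 := by
    simpa only [Fintype.linearCombination_apply, ← hc, smul_assoc] using hv0
  funext i
  rw [← hc, Fintype.linearIndependent_iff.1 hy c h_sum i, zero_smul, Pi.zero_apply]

variable [Module.Finite k V]

lemma exists_equiv_pi (hH : HasFixedVectors k H) (hl : IsFrobeniusForm l)
    (hL : (invariants k H H).restrictScalars k = k ∙ L) [Module.Projective H V] :
    ∃ r : ℕ, Nonempty (V ≃ₗ[H] (Fin r → H)) := by
  let b := Module.finBasis k (LinearMap.range (Algebra.lsmul k k V L))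
  choose y hy using fun i => (b i).2
  replace hy : (fun i => L • y i) = fun i => (b i : V) := funext hy
  let j := Fintype.linearCombination H y
  have hj : Function.Injective j := hH.linearCombination_injective hL <| by
    rw [hy]
    exact b.linearIndependent.map' (Submodule.subtype _) (Submodule.ker_subtype _)
  obtain ⟨q, hq⟩ := hl.exists_leftInverse j hj
  replace hq (x) : q (j x) = x := LinearMap.congr_fun hq x
  have h_range (u : V) : ∃ x, j x = L • u := by
    refine ⟨fun i => b.repr ⟨L • u, u, rfl⟩ i • L, ?_⟩
    have h_repr := congrArg Subtype.val (b.sum_repr ⟨L • u, u, rfl⟩)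
    simp only [Submodule.coe_sum, Submodule.coe_smul, ← congrFun hy] at h_repr
    simpa only [j, Fintype.linearCombination_apply, smul_assoc] using h_repr
  have hq_inj : Function.Injective q := hH.injective_of_invariants q fun v hv hqv => by
    obtain ⟨u, rfl⟩ := exists_smul_eq_of_mem_invariants hL hv
    obtain ⟨x, hx⟩ := h_range u
    rw [← hx, ← hq x, hx, hqv, map_zero]
  exact ⟨_, ⟨LinearEquiv.ofBijective q ⟨hq_inj, fun x => ⟨j x, hq x⟩⟩⟩⟩

end HasFixedVectors

section TrivialMod

variable {k : Type v} {H : Type u} [Field k] [Ring H] [HopfAlgebra k H]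

instance TrivialMod.instModuleBase : Module k (TrivialMod k H) := inferInstanceAs (Module k k)

instance TrivialMod.instFinite : Module.Finite k (TrivialMod k H) :=
  inferInstanceAs (Module.Finite k k)

instance TrivialMod.instIsScalarTower : IsScalarTower k H (TrivialMod k H) where
  smul_assoc c h (x : k) := by
    change counit (R := k) (c • h) * x = c * (counit (R := k) h * x)
    rw [map_smul, smul_eq_mul, mul_assoc]

/-- The unit of `k`, as a vector of the trivial module. -/
def TrivialMod.one : TrivialMod k H := (1 : k)

lemma TrivialMod.one_mem_invariants :
    TrivialMod.one ∈ invariants k H (TrivialMod k H) := fun _ => rfl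

lemma TrivialMod.exists_smul_one_eq (x : TrivialMod k H) : ∃ c : k, c • TrivialMod.one = x :=
  ⟨x, mul_one (M := k) x⟩

lemma finrank_trivialMod_prod_pi [Module.Finite k H] (r : ℕ) :
    Module.finrank k (TrivialMod k H × (Fin r → H)) = r * Module.finrank k H + 1 := by
  rw [Module.finrank_prod, Module.finrank_pi_fintype, Finset.sum_const, Finset.card_univ,
    Fintype.card_fin, smul_eq_mul, add_comm]
  exact congrArg _ (Module.finrank_self k)

variable {V : Type u} [AddCommGroup V] [Module k V] [Module H V] [IsScalarTower k H V]

lemma linearIndependent_smul_symm_single {L : H} (hL : L ≠ 0) {r : ℕ}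
    (e : V ≃ₗ[H] TrivialMod k H × (Fin r → H)) :
    LinearIndependent k fun i => L • e.symm (0, Pi.single i 1) := by
  have h_single (i : Fin r) : (e (L • e.symm (0, Pi.single i 1))).2 = Pi.single i L := by
    rw [map_smul, e.apply_symm_apply, Prod.smul_snd, ← Pi.single_smul, smul_eq_mul, mul_one]
  have h_image : LinearIndependent k fun i => (e (L • e.symm (0, Pi.single i 1))).2 := by
    rw [funext h_single]
    exact Pi.linearIndependent_single_of_ne_zero fun _ => hL
  exact .of_comp ((LinearMap.snd H _ _ ∘ₗ e.toLinearMap).restrictScalars k) h_image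

variable [Module.Finite k V]

lemma HasFixedVectors.nonempty_equiv_trivialMod (hH : HasFixedVectors k H)
    (hV : Module.finrank k V = 1) : Nonempty (V ≃ₗ[H] TrivialMod k H) := by
  have : Nontrivial V := Module.nontrivial_of_finrank_pos (R := k) (hV ▸ one_pos)
  obtain ⟨v, hv0, hv⟩ := hH V
  let f : TrivialMod k H →ₗ[H] V :=
    { LinearMap.toSpanSingleton k V v with
      map_smul' h (x : k) := by
        change (counit (R := k) h * x) • v = h • x • v
        rw [smul_comm, hv, ← mul_smul, mul_comm] }
  have hf : Function.Bijective f :=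
    ⟨smul_left_injective k hv0, (finrank_eq_one_iff_of_nonzero' v hv0).1 hV⟩
  exact ⟨(LinearEquiv.ofBijective f hf).symm⟩

variable [Module.Finite k H] {l : Module.Dual k H} {L : H}

lemma HasFixedVectors.nonempty_equiv_trivialMod_prod_pi (hH : HasFixedVectors k H)
    (hl : IsFrobeniusForm l) (hL : (invariants k H H).restrictScalars k = k ∙ L) {r : ℕ}
    {y : Fin r → V} (hV : Module.finrank k V = r * Module.finrank k H + 1)
    (hy : LinearIndependent k fun i => L • y i) :
    Nonempty (V ≃ₗ[H] TrivialMod k H × (Fin r → H)) := by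
  obtain ⟨q, hq⟩ := hl.exists_leftInverse _ (hH.linearCombination_injective hL hy)
  obtain ⟨e, -⟩ := (LinearMap.exact_subtype_ker_map q).splitSurjectiveEquiv
    (Submodule.subtype_injective _) ⟨_, hq⟩
  have : Module.Finite k (LinearMap.ker q) :=
    inferInstanceAs (Module.Finite k ((LinearMap.ker q).restrictScalars k))
  have h_ker : Module.finrank k (LinearMap.ker q) = 1 := by
    have h_dim := (e.restrictScalars k).finrank_eq
    rw [hV, Module.finrank_prod, Module.finrank_pi_fintype, Finset.sum_const, Finset.card_univ,
      Fintype.card_fin, smul_eq_mul] at h_dim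
    omega
  obtain ⟨f⟩ := hH.nonempty_equiv_trivialMod h_ker
  exact ⟨e ≪≫ₗ f.prodCongr (LinearEquiv.refl H _)⟩

end TrivialMod

/-! ## Tensor products of modules -/

/-- The tensor product of two modules over a bialgebra `H`, with the action
`h • (x ⊗ y) = ∑ h₍₁₎ • x ⊗ h₍₂₎ • y`. It is a type synonym of `X ⊗[k] Y`, which already carries the
action of `H` on the first factor. -/
def TensMod (k : Type u) (_ : Type v) (X Y : Type w) [Field k]
    [AddCommGroup X] [Module k X] [AddCommGroup Y] [Module k Y] : Type w :=
  X ⊗[k] Y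

namespace TensMod

section VectorSpace

variable (k : Type u) (H : Type v) (X Y : Type w) [Field k]
  [AddCommGroup X] [Module k X] [AddCommGroup Y] [Module k Y]

instance : AddCommGroup (TensMod k H X Y) := inferInstanceAs (AddCommGroup (X ⊗[k] Y))

instance : Module k (TensMod k H X Y) := inferInstanceAs (Module k (X ⊗[k] Y))

instance [Module.Finite k X] [Module.Finite k Y] : Module.Finite k (TensMod k H X Y) :=
  inferInstanceAs (Module.Finite k (X ⊗[k] Y))

lemma finrank_eq : Module.finrank k (TensMod k H X Y) = Module.finrank k X * Module.finrank k Y :=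
  Module.finrank_tensorProduct

/-- The pure tensors of `TensMod k H X Y`, as a bilinear map. -/
def tmul : X →ₗ[k] Y →ₗ[k] TensMod k H X Y := TensorProduct.mk k X Y

variable {k H X Y}

@[elab_as_elim]
lemma induction {p : TensMod k H X Y → Prop} (zero : p 0) (tmul : ∀ x y, p (tmul k H X Y x y))
    (add : ∀ x y, p x → p y → p (x + y)) (z : TensMod k H X Y) : p z :=
  TensorProduct.induction_on (motive := p) z zero tmul add

end VectorSpace

section Bialgebra

variable (k : Type u) (H : Type v) (X Y : Type w) [Field k] [Ring H] [Bialgebra k H]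
  [AddCommGroup X] [Module k X] [Module H X] [IsScalarTower k H X]
  [AddCommGroup Y] [Module k Y] [Module H Y] [IsScalarTower k H Y]

/-- The action of `H ⊗ H` on `X ⊗ Y`. -/
def tensorAct : H ⊗[k] H →ₐ[k] Module.End k (TensMod k H X Y) :=
  (Module.endTensorEndAlgHom (R := k) (S := k) (A := k) (M := X) (N := Y)).comp
    (Algebra.TensorProduct.map (Algebra.lsmul k k X) (Algebra.lsmul k k Y))

variable {X Y} in
lemma tensorAct_tmul (a b : H) (x : X) (y : Y) :
    tensorAct k H X Y (a ⊗ₜ b) (tmul k H X Y x y) = tmul k H X Y (a • x) (b • y) := rfl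

instance : Module H (TensMod k H X Y) :=
  Module.compHom _ ((tensorAct k H X Y).comp (Bialgebra.comulAlgHom k H)).toRingHom

variable {X Y} in
lemma smul_def (h : H) (z : TensMod k H X Y) : h • z = tensorAct k H X Y (comul (R := k) h) z := rfl

instance : IsScalarTower k H (TensMod k H X Y) where
  smul_assoc c h z := by rw [smul_def, map_smul, map_smul, LinearMap.smul_apply, smul_def]

variable {k H X Y}

lemma smul_tmul {ι : Type*} {h : H} (r : Coalgebra.Repr k h ι) (x : X) (y : Y) :
    h • tmul k H X Y x y = ∑ i ∈ r.index, tmul k H X Y (r.left i • x) (r.right i • y) := by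
  simp only [smul_def, ← r.eq, map_sum, LinearMap.sum_apply, tensorAct_tmul]

lemma smul_tmul_of_mem_invariants {x : X} (hx : x ∈ invariants k H X) (h : H) (y : Y) :
    h • tmul k H X Y x y = tmul k H X Y x (h • y) := by
  rw [smul_tmul (ℛ k h)]
  conv_rhs => rw [← Coalgebra.sum_counit_smul (ℛ k h), Finset.sum_smul, map_sum]
  refine Finset.sum_congr rfl fun i _ => ?_
  rw [hx, LinearMap.map_smul₂, smul_assoc, (tmul k H X Y x).map_smul]

end Bialgebra

variable {k : Type u} {H : Type v} {X Y : Type w} [Field k] [Ring H] [HopfAlgebra k H]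
  [AddCommGroup X] [Module k X] [Module H X] [IsScalarTower k H X]
  [AddCommGroup Y] [Module k Y] [Module H Y] [IsScalarTower k H Y]

lemma tmul_smul_left {ι : Type*} {h : H} (r : Coalgebra.Repr k h ι) (x : X) (y : Y) :
    tmul k H X Y (h • x) y = ∑ i ∈ r.index,
      r.left i • tmul k H X Y x (HopfAlgebra.antipode k (r.right i) • y) := by
  calc tmul k H X Y (h • x) y = tensorAct k H X Y (h ⊗ₜ 1) (tmul k H X Y x y) := by
        rw [tensorAct_tmul, one_smul]
    _ = _ := by
        rw [← sum_comul_mul_one_tmul_antipode r, map_sum, LinearMap.sum_apply]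
        exact Finset.sum_congr rfl fun i _ => by
          rw [map_mul, Module.End.mul_apply, tensorAct_tmul, one_smul, smul_def]

/-- The elements of `X` all of whose pure tensors lie in `S`. -/
def leftColon (S : Submodule H (TensMod k H X Y)) : Submodule H X where
  carrier := {x | ∀ y, tmul k H X Y x y ∈ S}
  add_mem' hx hx' y := by
    rw [map_add]
    exact S.add_mem (hx y) (hx' y)
  zero_mem' y := by
    rw [map_zero]
    exact S.zero_mem
  smul_mem' h x hx y := by
    rw [tmul_smul_left (ℛ k h)]
    exact S.sum_mem fun i _ => S.smul_mem _ (hx _)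

lemma eq_top_of_leftColon_eq_top {S : Submodule H (TensMod k H X Y)} (hS : leftColon S = ⊤) :
    S = ⊤ := by
  refine eq_top_iff.2 fun z _ => ?_
  induction z using TensMod.induction with
  | zero => exact S.zero_mem
  | add z z' hz hz' => exact S.add_mem (hz trivial) (hz' trivial)
  | tmul x y => exact (hS ▸ Submodule.mem_top : x ∈ leftColon S) y

end TensMod

section Free

variable {k : Type u} {H : Type v} {W M : Type w} [Field k] [Ring H] [HopfAlgebra k H]
  [AddCommGroup W] [Module k W] [Module H W] [IsScalarTower k H W]
  [AddCommGroup M] [Module k M] [Module H M] [IsScalarTower k H M]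

lemma eq_top_of_symm_mem {r : ℕ} {S : Submodule H W} (e : W ≃ₗ[H] TrivialMod k H × (Fin r → H))
    (h_triv : e.symm (TrivialMod.one, 0) ∈ S) (h_free : ∀ i, e.symm (0, Pi.single i 1) ∈ S) :
    S = ⊤ := by
  refine eq_top_iff.2 fun w _ => ?_
  obtain ⟨⟨x, y⟩, rfl⟩ := e.symm.surjective w
  obtain ⟨c, rfl⟩ := x.exists_smul_one_eq
  have h_decomp : ((c • TrivialMod.one, y) : TrivialMod k H × (Fin r → H)) =
      c • (TrivialMod.one, 0) + ∑ i, y i • (0, Pi.single i 1) := by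
    ext1
    · simp [Prod.fst_sum]
    · simp [Prod.snd_sum, ← Pi.single_smul, Finset.univ_sum_single]
  rw [h_decomp, map_add, map_sum, ← LinearEquiv.coe_coe, LinearMap.map_smul_of_tower]
  refine S.add_mem (S.smul_of_tower_mem _ h_triv) (S.sum_mem fun i _ => ?_)
  rw [map_smul]
  exact S.smul_mem _ (h_free i)

/-- The map `M × H ^ κ → W ⊗ M` that tensors with the fixed vector `w` on `M` and sends the basis
of the free module to `g`. -/
def tensorCover {κ : Type*} [Fintype κ] {w : W} (hw : w ∈ invariants k H W)
    (g : κ → TensMod k H W M) : M × (κ → H) →ₗ[H] TensMod k H W M :=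
  LinearMap.coprod
    { TensMod.tmul k H W M w with
      map_smul' h m := (TensMod.smul_tmul_of_mem_invariants hw h m).symm }
    (Fintype.linearCombination H g)

lemma tmul_mem_range_tensorCover {κ : Type*} [Fintype κ] {w : W} (hw : w ∈ invariants k H W)
    (g : κ → TensMod k H W M) (m : M) :
    TensMod.tmul k H W M w m ∈ LinearMap.range (tensorCover hw g) :=
  ⟨(m, 0), by simp [tensorCover]⟩

lemma mem_range_tensorCover {κ : Type*} [Fintype κ] {w : W} (hw : w ∈ invariants k H W)
    (g : κ → TensMod k H W M) (i : κ) : g i ∈ LinearMap.range (tensorCover hw g) := by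
  classical exact ⟨(0, Pi.single i 1), by simp [tensorCover]⟩

lemma tensorCover_surjective {ι : Type*} [Fintype ι] (b : Module.Basis ι k M) {r : ℕ}
    (e : W ≃ₗ[H] TrivialMod k H × (Fin r → H))
    (hw : e.symm (TrivialMod.one, 0) ∈ invariants k H W) :
    Function.Surjective (tensorCover hw fun ij : Fin r × ι =>
      TensMod.tmul k H W M (e.symm (0, Pi.single ij.1 1)) (b ij.2)) := by
  refine LinearMap.range_eq_top.1 (TensMod.eq_top_of_leftColon_eq_top (eq_top_of_symm_mem e ?_ ?_))
  · exact tmul_mem_range_tensorCover hw _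
  · intro i m
    rw [← b.sum_repr m, map_sum]
    refine Submodule.sum_mem _ fun j _ => ?_
    rw [map_smul]
    exact Submodule.smul_of_tower_mem _ _ (mem_range_tensorCover hw _ (i, j))

lemma nonempty_tensMod_equiv_prod_pi [Module.Finite k H] [Module.Finite k M] {r : ℕ}
    (e : W ≃ₗ[H] TrivialMod k H × (Fin r → H)) :
    Nonempty (TensMod k H W M ≃ₗ[H] M × (Fin r × Fin (Module.finrank k M) → H)) := by
  have : Module.Finite k W := Module.Finite.equiv (e.restrictScalars k).symm
  have hw : e.symm (TrivialMod.one, 0) ∈ invariants k H W :=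
    map_mem_invariants (e.symm.toLinearMap ∘ₗ LinearMap.inl H _ _) TrivialMod.one_mem_invariants
  have h_surj := tensorCover_surjective (Module.finBasis k M) e hw
  have h_dim : Module.finrank k (M × (Fin r × Fin (Module.finrank k M) → H)) =
      Module.finrank k (TensMod k H W M) := by
    rw [TensMod.finrank_eq, (e.restrictScalars k).finrank_eq, finrank_trivialMod_prod_pi,
      Module.finrank_prod, Module.finrank_pi_fintype, Finset.sum_const, Finset.card_univ,
      Fintype.card_prod, Fintype.card_fin, Fintype.card_fin, smul_eq_mul]
    ring
  have h_inj := (LinearMap.injective_iff_surjective_of_finrank_eq_finrank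
    (f := (tensorCover hw _).restrictScalars k) h_dim).2 h_surj
  exact ⟨(LinearEquiv.ofBijective (tensorCover hw _) ⟨h_inj, h_surj⟩).symm⟩

end Free

/-! ## Spaces of linear maps -/

namespace HomMod

section VectorSpace

variable (k : Type u) (H : Type v) (M N : Type w) [Field k] [Ring H] [HopfAlgebra k H]
  [AddCommGroup M] [Module k M] [AddCommGroup N] [Module k N]

instance : Module k (HomMod k H M N) := inferInstanceAs (Module k (M →ₗ[k] N))

/-- `HomMod.of` as a linear equivalence. -/
def lof : (M →ₗ[k] N) ≃ₗ[k] HomMod k H M N := LinearEquiv.refl k _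

variable [Module.Finite k M] [Module.Finite k N]

instance : Module.Finite k (HomMod k H M N) := inferInstanceAs (Module.Finite k (M →ₗ[k] N))

lemma finrank_eq :
    Module.finrank k (HomMod k H M N) = Module.finrank k M * Module.finrank k N :=
  Module.finrank_linearMap k k M N

end VectorSpace

variable {k : Type u} {H : Type v} {M N : Type w} [Field k] [Ring H] [HopfAlgebra k H]
  [AddCommGroup M] [Module k M] [Module H M] [IsScalarTower k H M]
  [AddCommGroup N] [Module k N] [Module H N] [IsScalarTower k H N]

instance : IsScalarTower k H (HomMod k H M N) where
  smul_assoc c h f := LinearMap.congr_fun (map_smul (act k H M N) c h) f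

lemma lof_symm_smul_apply {ι : Type*} {h : H} (r : Coalgebra.Repr k h ι) (f : HomMod k H M N)
    (m : M) : (lof k H M N).symm (h • f) m =
      ∑ i ∈ r.index, r.left i • (lof k H M N).symm f (HopfAlgebra.antipode k (r.right i) • m) :=
  smul_apply k H M N h r f m

end HomMod

section VectorSpace

variable (k : Type u) (H : Type v) (M X Y : Type w) [Field k] [AddCommGroup M] [Module k M]
  [AddCommGroup X] [Module k X] [AddCommGroup Y] [Module k Y]

/-- The linear equivalence underlying `tensComm`. -/
def tensCommₗ : TensMod k H X Y ≃ₗ[k] TensMod k H Y X := TensorProduct.comm k X Y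

/-- The linear equivalence underlying `homTens`. -/
def homTensₗ [Ring H] [HopfAlgebra k H] [Module.Finite k M] :
    TensMod k H (HomMod k H M X) Y ≃ₗ[k] HomMod k H M (TensMod k H X Y) :=
  rTensorHomEquivHomRTensor k M X Y

variable {k H M X Y}

lemma tensCommₗ_tmul (x : X) (y : Y) :
    tensCommₗ k H X Y (TensMod.tmul k H X Y x y) = TensMod.tmul k H Y X y x := rfl

lemma lof_symm_homTensₗ_tmul [Ring H] [HopfAlgebra k H] [Module.Finite k M]
    (f : HomMod k H M X) (y : Y) (m : M) :
    (HomMod.lof k H M _).symm (homTensₗ k H M X Y (TensMod.tmul k H _ Y f y)) m =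
      TensMod.tmul k H X Y ((HomMod.lof k H M X).symm f m) y := by
  have h := LinearMap.congr_fun (rTensorHomEquivHomRTensor_toLinearMap k M X Y)
    ((HomMod.lof k H M X).symm f ⊗ₜ y)
  exact (LinearMap.congr_fun h m).trans (rTensorHomToHomRTensor_apply ..)

end VectorSpace

section HomTensor

variable {k : Type u} {H : Type v} {M X Y : Type w} [Field k] [Ring H] [HopfAlgebra k H]
  [AddCommGroup M] [Module k M] [Module H M] [IsScalarTower k H M]
  [AddCommGroup X] [Module k X] [Module H X] [IsScalarTower k H X]
  [AddCommGroup Y] [Module k Y] [Module H Y] [IsScalarTower k H Y]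

/-- A `k`-linear equivalence out of `X ⊗ Y` that is equivariant on pure tensors, as an `H`-linear
equivalence. -/
def TensMod.equivOfTmul {Z : Type*} [AddCommGroup Z] [Module k Z] [Module H Z]
    (e : TensMod k H X Y ≃ₗ[k] Z)
    (he : ∀ (h : H) x y, e (h • tmul k H X Y x y) = h • e (tmul k H X Y x y)) :
    TensMod k H X Y ≃ₗ[H] Z :=
  { e with
    map_smul' h z := by
      change e (h • z) = h • e z
      induction z using TensMod.induction with
      | zero => simp only [smul_zero, map_zero]
      | tmul x y => exact he h x y
      | add z z' hz hz' => simp only [smul_add, map_add, hz, hz'] }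

/-- The symmetry of the tensor product over a cocommutative Hopf algebra. -/
def tensComm [IsCocomm k H] : TensMod k H X Y ≃ₗ[H] TensMod k H Y X :=
  TensMod.equivOfTmul (tensCommₗ k H X Y) fun h x y => by
    rw [TensMod.smul_tmul (ℛ k h), map_sum, tensCommₗ_tmul, TensMod.smul_tmul (reprSwap (ℛ k h))]
    rfl

/-- `Hom_k(M, -)` applied to an isomorphism of `H`-modules. -/
def homCongr (e : X ≃ₗ[H] Y) : HomMod k H M X ≃ₗ[H] HomMod k H M Y :=
  { LinearEquiv.congrRight (e.restrictScalars k) with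
    map_smul' h f := (HomMod.lof k H M Y).symm.injective <| LinearMap.ext fun m => by
      refine (congrArg e (HomMod.lof_symm_smul_apply (ℛ k h) f m)).trans ?_
      rw [map_sum]
      refine .trans ?_ (HomMod.lof_symm_smul_apply (N := Y) (ℛ k h) _ m).symm
      exact Finset.sum_congr rfl fun i _ => map_smul e _ _ }

/-- The isomorphism `Hom_k(M, X) ⊗ Y ≅ Hom_k(M, X ⊗ Y)`. -/
def homTens [IsCocomm k H] [Module.Finite k M] :
    TensMod k H (HomMod k H M X) Y ≃ₗ[H] HomMod k H M (TensMod k H X Y) :=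
  TensMod.equivOfTmul (homTensₗ k H M X Y) fun h f y =>
    (HomMod.lof k H M _).symm.injective <| LinearMap.ext fun m => by
      let r := ℛ k h
      let r₁ := fun i => ℛ k (r.left i)
      let F := (HomMod.lof k H M X).symm f
      let S := HopfAlgebra.antipode k (A := H)
      calc _ = ∑ i ∈ r.index, ∑ j ∈ (r₁ i).index, TensMod.tmul k H X Y
              ((r₁ i).left j • F (S ((r₁ i).right j) • m)) (r.right i • y) := by
            rw [TensMod.smul_tmul r, map_sum, map_sum, LinearMap.sum_apply]
            refine Finset.sum_congr rfl fun i _ => ?_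
            rw [lof_symm_homTensₗ_tmul, HomMod.lof_symm_smul_apply (r₁ i), map_sum,
              LinearMap.sum_apply]
        _ = ∑ i ∈ r.index, ∑ j ∈ (r₁ i).index, TensMod.tmul k H X Y
              ((r₁ i).left j • F (S (r.right i) • m)) ((r₁ i).right j • y) :=
            sum_repr_swap_right r r₁
              (T := fun a b c => TensMod.tmul k H X Y (a • F (S b • m)) (c • y))
              (fun b c => ⟨by simp [add_smul], by simp⟩)
              (fun a c => ⟨by simp [add_smul], by simp [smul_comm a]⟩)
              (fun a b => ⟨by simp [add_smul], by simp⟩)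
        _ = _ := by
            rw [HomMod.lof_symm_smul_apply r]
            refine Finset.sum_congr rfl fun i _ => ?_
            rw [lof_symm_homTensₗ_tmul, TensMod.smul_tmul (r₁ i)]

/-- The isomorphism `Hom_k(M, X) ⊗ Y ≅ Hom_k(M, Y) ⊗ X`. -/
def homTensSwap [IsCocomm k H] [Module.Finite k M] :
    TensMod k H (HomMod k H M X) Y ≃ₗ[H] TensMod k H (HomMod k H M Y) X :=
  homTens ≪≫ₗ homCongr tensComm ≪≫ₗ homTens.symm

end HomTensor

/-! ## Endotrivial modules -/

section Endotrivial

variable {k : Type v} {H M N : Type u} [Field k] [Ring H] [HopfAlgebra k H] [Module.Finite k H]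
  [AddCommGroup M] [Module k M] [Module H M] [IsScalarTower k H M]
  [AddCommGroup N] [Module k N] [Module H N] [IsScalarTower k H N]

lemma IsEndotrivial.exists_equiv_trivialMod_prod_pi [IsCocomm k H] (hH : HasFixedVectors k H)
    (hM : IsEndotrivial k H M) :
    ∃ r : ℕ, Nonempty (HomMod k H M M ≃ₗ[H] TrivialMod k H × (Fin r → H)) := by
  obtain ⟨_, P, _, _, _, ⟨e⟩⟩ := hM
  let _ : Module k P := Module.compHom P (algebraMap k H)
  have : IsScalarTower k H P := ⟨fun c h x => by
    rw [Algebra.smul_def, mul_smul]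
    rfl⟩
  have : Module.Finite k P :=
    .of_surjective ((LinearMap.snd H _ P ∘ₗ e.toLinearMap).restrictScalars k)
      (Prod.snd_surjective.comp e.surjective)
  obtain ⟨l, hl⟩ := hH.exists_isFrobeniusForm
  obtain ⟨L, -, hL⟩ := hl.exists_span_eq_invariants
  obtain ⟨r, ⟨f⟩⟩ := hH.exists_equiv_pi hl hL (V := P)
  exact ⟨r, ⟨e ≪≫ₗ (LinearEquiv.refl H _).prodCongr f⟩⟩

lemma HasFixedVectors.nonempty_equiv_of_homMod_equiv [IsCocomm k H] (hH : HasFixedVectors k H)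
    [Module.Finite k M] [Module.Finite k N] (hMN : Module.finrank k N = Module.finrank k M) {r : ℕ}
    (eM : HomMod k H M M ≃ₗ[H] TrivialMod k H × (Fin r → H))
    (eN : HomMod k H M N ≃ₗ[H] TrivialMod k H × (Fin r → H)) : Nonempty (N ≃ₗ[H] M) := by
  obtain ⟨e₁⟩ := nonempty_tensMod_equiv_prod_pi (M := N) eM
  obtain ⟨e₂⟩ := nonempty_tensMod_equiv_prod_pi (M := M) eN
  rw [hMN] at e₁
  have := hH.isLocalRing
  exact nonempty_equiv_of_prod_pi_equiv (e₁.symm ≪≫ₗ homTensSwap ≪≫ₗ e₂)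

end Endotrivial

/-! ## Openness of isomorphism classes -/

lemma exists_eval_ne_zero_of_linearIndependent {k W U σ ι : Type*} [Field k] [AddCommGroup W]
    [Module k W] [AddCommGroup U] [Module k U] [Finite σ] [Finite ι] (b : Module.Basis σ k W)
    (γ : ι → W →ₗ[k] U) {w₀ : W}
    (hw₀ : LinearIndependent k fun i => γ i w₀) :
    ∃ f : MvPolynomial σ k, f.eval (b.repr w₀) ≠ 0 ∧
      ∀ w, f.eval (b.repr w) ≠ 0 → LinearIndependent k fun i => γ i w := by
  classical
  cases nonempty_fintype σ
  cases nonempty_fintype ι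
  obtain ⟨φ, hφ⟩ : ∃ φ : U →ₗ[k] ι → k, ∀ i, φ (γ i w₀) = Pi.single i 1 := by
    obtain ⟨φ, hφ⟩ := (Fintype.linearCombination k fun i => γ i w₀).exists_leftInverse_of_injective
      (LinearMap.ker_eq_bot.2 hw₀.fintypeLinearCombination_injective)
    exact ⟨φ, fun i => by simpa using LinearMap.congr_fun hφ (Pi.single i 1)⟩
  let A (w : W) : Matrix ι ι k := Matrix.of fun i => φ (γ i w)
  let f : MvPolynomial σ k := Matrix.det (Matrix.of fun i j =>
    ∑ s, MvPolynomial.X s * MvPolynomial.C (A (b s) i j))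
  have hf (w : W) : f.eval (b.repr w) = (A w).det := by
    rw [RingHom.map_det]
    congr 1
    ext i j
    refine .trans ?_ (congrFun (congrArg (φ ∘ₗ γ i) (b.sum_repr w)) j)
    simp [A, -Module.Basis.sum_repr]
  refine ⟨f, ?_, fun w hw => .of_comp φ ?_⟩
  · have h_one : A w₀ = 1 := Matrix.ext fun i j => by
      simp [A, hφ, Pi.single_apply, Matrix.one_apply, eq_comm]
    rw [hf, h_one, Matrix.det_one]
    exact one_ne_zero
  · exact Matrix.linearIndependent_rows_of_det_ne_zero (hf w ▸ hw)

lemma exists_finset_eval_ne_zero {R σ : Type*} [CommRing R] [IsNoetherianRing R] [Finite σ]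
    (S : Set (MvPolynomial σ R)) :
    ∃ T : Finset (MvPolynomial σ R), ↑T ⊆ S ∧
      ∀ x : σ → R, ∀ f ∈ S, f.eval x ≠ 0 → ∃ g ∈ T, g.eval x ≠ 0 := by
  obtain ⟨T, hTS, hT⟩ := (Submodule.fg_span_iff_fg_span_finset_subset S).1
    (IsNoetherian.noetherian (Ideal.span S))
  refine ⟨T, hTS, fun x f hf hfx => ?_⟩
  by_contra! h
  have h_le : Ideal.span (T : Set (MvPolynomial σ R)) ≤ RingHom.ker (MvPolynomial.eval x) :=
    Ideal.span_le.2 h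
  exact hfx (h_le (hT.le (Ideal.subset_span hf)))

/-- The action of `H` on `N`, transported to the vector space `V` along `e`. -/
def transportedAction {k N V : Type*} (H : Type*) [Field k] [Ring H] [Algebra k H]
    [AddCommGroup N] [Module k N] [Module H N] [IsScalarTower k H N] [AddCommGroup V] [Module k V]
    (e : V ≃ₗ[k] N) : H →ₗ[k] Module.End k V :=
  e.symm.conj.toLinearMap ∘ₗ (Algebra.lsmul k k N).toLinearMap

section Twist

variable {k : Type v} {H : Type w} {M N : Type u} {V : Type*} [Field k] [Ring H] [HopfAlgebra k H]
  [AddCommGroup V] [Module k V] [AddCommGroup M] [Module k M] [Module H M] [IsScalarTower k H M]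
  [AddCommGroup N] [Module k N] [Module H N] [IsScalarTower k H N]

/-- The action of `h` on `f ∈ Hom_k(M, V)` when `H` acts on `V` through `ρ`, as a linear function
of `ρ`; here `ρ` may be any linear map, so that it ranges over a vector space. -/
def twist (h : H) (f : M →ₗ[k] V) : (H →ₗ[k] Module.End k V) →ₗ[k] M →ₗ[k] V :=
  ∑ i ∈ (ℛ k h).index, LinearMap.lcomp k V
      (f ∘ₗ Algebra.lsmul k k M (HopfAlgebra.antipode k ((ℛ k h).right i))) ∘ₗ
    LinearMap.applyₗ ((ℛ k h).left i)

lemma smul_lof_comp (e : V ≃ₗ[k] N) (h : H) (f : M →ₗ[k] V) :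
    h • HomMod.lof k H M N (e.toLinearMap ∘ₗ f) =
      HomMod.lof k H M N (e.toLinearMap ∘ₗ twist h f (transportedAction H e)) :=
  (HomMod.lof k H M N).symm.injective <| LinearMap.ext fun m => by
    rw [HomMod.lof_symm_smul_apply (ℛ k h)]
    simp [twist, transportedAction, LinearMap.sum_apply]

lemma linearIndependent_smul_lof_comp_iff {ι : Type*} (e : V ≃ₗ[k] N) (h : H)
    (f : ι → M →ₗ[k] V) :
    (LinearIndependent k fun i => h • HomMod.lof k H M N (e.toLinearMap ∘ₗ f i)) ↔
      LinearIndependent k fun i => twist h (f i) (transportedAction H e) := by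
  rw [funext fun i => smul_lof_comp e h (f i)]
  exact (e.congrRight ≪≫ₗ HomMod.lof k H M N).toLinearMap.linearIndependent_iff
    (LinearEquiv.ker _)

end Twist

lemma IsEndotrivial.exists_eval_ne_zero {k : Type v} {H M : Type u} [Field k] [Ring H]
    [HopfAlgebra k H] [Module.Finite k H] [IsCocomm k H] (hH : HasFixedVectors k H)
    [AddCommGroup M] [Module k M] [Module H M] [IsScalarTower k H M] (hM : IsEndotrivial k H M)
    {V σ : Type*} [AddCommGroup V] [Module k V] [Finite σ]
    (b : Module.Basis σ k (H →ₗ[k] Module.End k V)) (e₀ : V ≃ₗ[k] M) :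
    ∃ f : MvPolynomial σ k, f.eval (b.repr (transportedAction H e₀)) ≠ 0 ∧
      ∀ (N : Type u) [AddCommGroup N] [Module k N] [Module H N] [IsScalarTower k H N]
        (e : V ≃ₗ[k] N), f.eval (b.repr (transportedAction H e)) ≠ 0 → Nonempty (N ≃ₗ[H] M) := by
  have : Module.Finite k M := hM.1
  obtain ⟨r, ⟨eM⟩⟩ := hM.exists_equiv_trivialMod_prod_pi hH
  obtain ⟨l, hl⟩ := hH.exists_isFrobeniusForm
  obtain ⟨L, hL0, hL⟩ := hl.exists_span_eq_invariants
  let y (i : Fin r) : M →ₗ[k] V :=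
    e₀.symm.toLinearMap ∘ₗ (HomMod.lof k H M M).symm (eM.symm (0, Pi.single i 1))
  have hy : LinearIndependent k fun i => twist L (y i) (transportedAction H e₀) := by
    rw [← linearIndependent_smul_lof_comp_iff]
    simpa [y, ← LinearMap.comp_assoc] using linearIndependent_smul_symm_single hL0 eM
  obtain ⟨f, hf, hfy⟩ := exists_eval_ne_zero_of_linearIndependent b (fun i => twist L (y i)) hy
  refine ⟨f, hf, fun N _ _ _ _ e he => ?_⟩
  have : Module.Finite k N := Module.Finite.equiv (e₀.symm ≪≫ₗ e)
  have h_finrank : Module.finrank k N = Module.finrank k M := (e.symm ≪≫ₗ e₀).finrank_eq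
  have h_hom : Module.finrank k (HomMod k H M N) = r * Module.finrank k H + 1 := by
    rw [HomMod.finrank_eq, h_finrank, ← HomMod.finrank_eq k H, (eM.restrictScalars k).finrank_eq,
      finrank_trivialMod_prod_pi]
  obtain ⟨eN⟩ := hH.nonempty_equiv_trivialMod_prod_pi hl hL h_hom
    ((linearIndependent_smul_lof_comp_iff e L y).2 (hfy _ he))
  exact hH.nonempty_equiv_of_homMod_equiv h_finrank eM eN

end

end FinGroupScheme

theorem theorem3p5_general {k : Type v} {H : Type u} [Field k] [Ring H] [HopfAlgebra k H]
    [Module.Finite k H] [IsCocomm k H] (hH : HasFixedVectors k H) (n : ℕ) :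
    ∃ (m : ℕ) (N : Fin m → ModuleCat.{u} H),
      ∀ (M : Type u) [AddCommGroup M] [Module k M] [Module H M] [IsScalarTower k H M],
        IsEndotrivial k H M → Module.finrank k M = n → ∃ i : Fin m, Nonempty (M ≃ₗ[H] N i) := by
  let V := Fin n → k
  let b := Module.finBasis k (H →ₗ[k] Module.End k V)
  let S := {f : MvPolynomial _ k | ∃ M₀ : ModuleCat.{u} H, ∀ (M : Type u) [AddCommGroup M]
    [Module k M] [Module H M] [IsScalarTower k H M] (e : V ≃ₗ[k] M),
      f.eval (b.repr (transportedAction H e)) ≠ 0 → Nonempty (M ≃ₗ[H] M₀)}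
  obtain ⟨T, hTS, hT⟩ := exists_finset_eval_ne_zero S
  choose N hN using fun f : T => hTS f.2
  refine ⟨T.card, N ∘ T.equivFin.symm, fun M _ _ _ _ hM hn => ?_⟩
  have : Module.Finite k M := hM.1
  let e : V ≃ₗ[k] M := (Module.finBasisOfFinrankEq k M hn).equivFun.symm
  obtain ⟨f, hf, hfM⟩ := hM.exists_eval_ne_zero hH b e
  obtain ⟨g, hgT, hg⟩ := hT _ f ⟨ModuleCat.of H M, hfM⟩ hf
  refine ⟨T.equivFin ⟨g, hgT⟩, ?_⟩
  rw [Function.comp_apply, Equiv.symm_apply_apply]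
  exact hN ⟨g, hgT⟩ M e hg

theorem theorem3p5 (p : ℕ) [Fact p.Prime] (k : Type u) [Field k] [IsAlgClosed k] [CharP k p]
    (G : Scheme.{u}) [G.Over (Spec (.of k))] [GrpObj (G.asOver (Spec (.of k)))]
    [IsAffine G] [Module.Finite k (CoordRing k G)] (hG : IsUnipotent k G)
    (n : ℕ) (hn : 0 < n) :
    ∃ (m : ℕ) (N : Fin m → ModuleCat.{u} (GroupSchemeAlg k G)),
      ∀ (M : Type u) [AddCommGroup M] [Module k M] [Module (GroupSchemeAlg k G) M]
        [IsScalarTower k (GroupSchemeAlg k G) M],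
        IsEndotrivial k (GroupSchemeAlg k G) M → Module.finrank k M = n →
          ∃ i : Fin m, Nonempty (M ≃ₗ[GroupSchemeAlg k G] N i) :=
  theorem3p5_general hG n
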